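/- For $\tau$ in the complex upper half-plane $\mathbb{H}$ put $q^{r}=e^{2\pi i r\tau}$ ($r\in\mathbb{Q}$) and let $X(\tau)$ be the continued fraction of order six, $$X(\tau)=\frac{q^{7/4}}{q^2-1}\left(1-q^{-3/2}+\cfrac{(q^{1/4}-q^{-1/4})(q^{-7/4}-q^{7/4})}{(1-q^{-3/2})(1+q^3)+\cfrac{(q^{1/4}-q^{11/4})(q^{-7/4}-q^{19/4})}{(1-q^{-3/2})(1+q^6)+\ddots}}\right)=q^{1/4}\prod_{n=1}^{\infty}\frac{(1-q^{6n-1})(1-q^{6n-5})}{(1-q^{6n-2})(1-q^{6n-4})},$$ where the $n$-th partial numerator ($n\ge 1$) is $(q^{1/4}-q^{3n-13/4})(q^{-7/4}-q^{3n-5/4})$ and the $n$-th partial denominator is $(1-q^{-3/2})(1+q^{3n})$. Let $w(\tau)=X(\tau)X(3\tau)$. Then for every $\tau\in\mathbb{H}$ the convergents of the continued fraction tend to the value $X(\tau)$ of the infinite product, $1-3w(\tau)+3w(\tau)^2\neq 0$, and $$X(\tau)^4=w(\tau)\bigl(1-3w(\tau)+3w(\tau)^2\bigr),\qquad X(3\tau)^4=\frac{w(\tau)^3}{1-3w(\tau)+3w(\tau)^2}.$$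 -/

import Mathlib

namespace OrderSix

noncomputable section

/-- The power `q ^ r = exp (2 π i r τ)` of the nome `q = exp (2 π i τ)`, for rational `r`. -/
def qpow (r : ℚ) (τ : ℂ) : ℂ :=
  Complex.exp (2 * (Real.pi : ℂ) * Complex.I * (r : ℂ) * τ)

/-- `X(τ) = q^{1/4} ∏_{n ≥ 1} (1 - q^{6n-1})(1 - q^{6n-5}) / ((1 - q^{6n-2})(1 - q^{6n-4}))`;
the index `n` of the product below is `n - 1` there. -/
def X (τ : ℂ) : ℂ :=
  qpow (1 / 4) τ *
    ∏' n : ℕ, ((1 - qpow (6 * n + 5) τ) * (1 - qpow (6 * n + 1) τ)) /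
      ((1 - qpow (6 * n + 4) τ) * (1 - qpow (6 * n + 2) τ))

/-- The continued fraction
`(1 - q^{-3/2}) + a₀ / (b₀ + a₁ / (b₁ + ⋯))` with partial numerators
`aₙ = (q^{1/4} - q^{3n - 1/4}) (q^{-7/4} - q^{3n + 7/4})` and partial denominators
`bₙ = (1 - q^{-3/2}) (1 + q^{3n + 3})`. -/
def contFract (τ : ℂ) : GenContFract ℂ where
  h := 1 - qpow (-3 / 2) τ
  s := Stream'.Seq.ofStream fun n : ℕ =>
    { a := (qpow (1 / 4) τ - qpow (3 * n - 1 / 4) τ) *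
        (qpow (-7 / 4) τ - qpow (3 * n + 7 / 4) τ)
      b := (1 - qpow (-3 / 2) τ) * (1 + qpow (3 * n + 3) τ) }

/-- The `n`-th convergent of the continued fraction expansion of `X(τ)`, that is, of
`q^{7/4} / (q² - 1)` times the continued fraction `contFract τ`. -/
def convergent (τ : ℂ) (n : ℕ) : ℂ :=
  qpow (7 / 4) τ / (qpow 2 τ - 1) * (contFract τ).convs n

/-- `w(τ) = X(τ) X(3τ)`. -/
def w (τ : ℂ) : ℂ := X τ * X (3 * τ)

end

end OrderSix

/-! Modular equations. Put `psi q` = ∑ q^(n(n+1)/2). Gauss's product (`psi_eq`) turns X into q^(1/4)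
psi(q³)/psi(q) (`X_eq_psi`), so w = q psi(q⁹)/psi(q). Everything then follows from Ramanujan's
relation between psi(q), psi(q³), psi(q⁹) (`psi_pow_four`). To get it, write psi(q) = A + qB with B
= psi(q⁹) and A a series in q³. The values of psi at q, ωq, ω²q are A + ω^j qB, with product A³ +
q³B³, while the product formulas identify this product with psi(q³)⁴/B (`psi_cube`).

Continued fraction. With h = q^(1/2), its three-term recurrence is solved by an explicit product
times a ₂φ₁ series of base h⁶ at z = h^(6n) (`cfSeries_recurrence`). This solution is minimal, so a
Pincherle argument (`tendsto_convs_of_minimal`) gives the limit from its first two values. At z = 1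
the base becomes h¹², and the q-binomial theorem sums both the series and the combination needed
(`cfSeries_one`, `cfSeries_combination`). -/

open Filter Topology Finset

namespace OrderSix

noncomputable section

/-! ### Shifted factorials: limits, splitting and uniform bounds. -/

/-- The finite `q`-shifted factorial `(a; p)_k`. -/
def qPoch (a p : ℂ) (k : ℕ) : ℂ := ∏ i ∈ range k, (1 - a * p ^ i)

/-- The infinite `q`-shifted factorial `(a; p)_∞`. -/
def qProd (a p : ℂ) : ℂ := ∏' i : ℕ, (1 - a * p ^ i)

@[simp] lemma qPoch_zero (a p : ℂ) : qPoch a p 0 = 1 := by simp [qPoch]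

lemma qPoch_succ (a p : ℂ) (k : ℕ) : qPoch a p (k + 1) = qPoch a p k * (1 - a * p ^ k) :=
  prod_range_succ _ _

lemma qPoch_succ' (a p : ℂ) (k : ℕ) : qPoch a p (k + 1) = (1 - a) * qPoch (a * p) p k := by
  rw [qPoch, prod_range_succ', mul_comm, qPoch, pow_zero, mul_one]
  congr 1
  exact prod_congr rfl fun i _ => by ring

lemma summable_mul_geometric {p : ℂ} (hp : ‖p‖ < 1) (a : ℂ) :
    Summable fun i : ℕ => ‖-(a * p ^ i)‖ := by
  simpa [norm_mul, norm_pow] using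
    (summable_geometric_of_lt_one (norm_nonneg p) hp).mul_left ‖a‖

lemma multipliable_qProd {p : ℂ} (hp : ‖p‖ < 1) (a : ℂ) :
    Multipliable fun i : ℕ => 1 - a * p ^ i := by
  simpa [sub_eq_add_neg] using multipliable_one_add_of_summable (summable_mul_geometric hp a)

lemma tendsto_qPoch {p : ℂ} (hp : ‖p‖ < 1) (a : ℂ) :
    Tendsto (qPoch a p) atTop (𝓝 (qProd a p)) :=
  (multipliable_qProd hp a).tendsto_prod_tprod_nat

lemma one_sub_ne_zero_of_norm_lt {x : ℂ} (hx : ‖x‖ < 1) : 1 - x ≠ 0 := by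
  intro h
  rw [← sub_eq_zero.mp h] at hx
  simp at hx

lemma norm_mul_pow_lt_one {a p : ℂ} (hp : ‖p‖ < 1) (ha : ‖a‖ < 1) (i : ℕ) :
    ‖a * p ^ i‖ < 1 := by
  rw [norm_mul, norm_pow]
  exact mul_lt_one_of_nonneg_of_lt_one_left (norm_nonneg _) ha
    (pow_le_one₀ (norm_nonneg _) hp.le)

lemma qPoch_ne_zero {a p : ℂ} (hp : ‖p‖ < 1) (ha : ‖a‖ < 1) (k : ℕ) : qPoch a p k ≠ 0 :=
  prod_ne_zero_iff.mpr fun i _ => one_sub_ne_zero_of_norm_lt (norm_mul_pow_lt_one hp ha i)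

lemma qProd_ne_zero {a p : ℂ} (hp : ‖p‖ < 1) (ha : ‖a‖ < 1) : qProd a p ≠ 0 := by
  have := tprod_one_add_ne_zero_of_summable (f := fun i : ℕ => -(a * p ^ i))
    (fun i => by
      simpa [sub_eq_add_neg] using one_sub_ne_zero_of_norm_lt (norm_mul_pow_lt_one hp ha i))
    (summable_mul_geometric hp a)
  simpa [qProd, sub_eq_add_neg] using this

/-- Splitting `(a; p)_∞` according to the residue of the index modulo `m`. -/
lemma qProd_eq_prod {p : ℂ} (hp : ‖p‖ < 1) (a : ℂ) {m : ℕ} (hm : 0 < m) :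
    qProd a p = ∏ i ∈ range m, qProd (a * p ^ i) (p ^ m) := by
  have hpm : ‖p ^ m‖ < 1 := by
    rw [norm_pow]
    exact pow_lt_one₀ (norm_nonneg _) hp hm.ne'
  have h1 : Tendsto (fun N => qPoch a p (m * N)) atTop (𝓝 (qProd a p)) :=
    (tendsto_qPoch hp a).comp (tendsto_id.const_mul_atTop' hm)
  have h2 : Tendsto (fun N => ∏ i ∈ range m, qPoch (a * p ^ i) (p ^ m) N) atTop
      (𝓝 (∏ i ∈ range m, qProd (a * p ^ i) (p ^ m))) :=
    tendsto_finsetProd _ fun i _ => tendsto_qPoch hpm _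
  refine tendsto_nhds_unique h1 (h2.congr fun N => ?_)
  induction N with
  | zero => simp
  | succ N ih =>
    rw [Nat.mul_succ, qPoch, prod_range_add, ← qPoch, ← ih, ← prod_mul_distrib]
    refine prod_congr rfl fun i _ => ?_
    rw [qPoch_succ, pow_add, pow_mul]
    ring

/-- The convergent sequence (-R; |p|)_k is a majorant for all a in the disc at once; such uniformity
is what dominated convergence needs later. -/
lemma exists_norm_qPoch_le {p : ℂ} (hp : ‖p‖ < 1) (R : ℝ) :
    ∃ C, ∀ a : ℂ, ‖a‖ ≤ R → ∀ k, ‖qPoch a p k‖ ≤ C := by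
  have hr : ‖((‖p‖ : ℝ) : ℂ)‖ < 1 := by simpa using hp
  obtain ⟨C, hC⟩ := (tendsto_qPoch hr (-R : ℂ)).norm.bddAbove_range
  refine ⟨C, fun a ha k => le_trans ?_ (hC ⟨k, rfl⟩)⟩
  simp only [qPoch, norm_prod]
  refine prod_le_prod (fun _ _ => norm_nonneg _) fun i _ => ?_
  have hR : 0 ≤ R := (norm_nonneg a).trans ha
  have : (1 - -(R : ℂ) * ((‖p‖ : ℝ) : ℂ) ^ i) = ((1 + R * ‖p‖ ^ i : ℝ) : ℂ) := by
    push_cast; ring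
  rw [this, Complex.norm_real, Real.norm_of_nonneg (by positivity)]
  refine (norm_sub_le _ _).trans ?_
  rw [norm_one, norm_mul, norm_pow]
  gcongr

/-- Here (|p|; |p|)_k bounds the factorial from below, and its limit is nonzero. -/
lemma exists_norm_inv_qPoch_le {p : ℂ} (hp : ‖p‖ < 1) :
    ∃ C, ∀ a : ℂ, ‖a‖ ≤ ‖p‖ → ∀ k, ‖(qPoch a p k)⁻¹‖ ≤ C := by
  have hr : ‖((‖p‖ : ℝ) : ℂ)‖ < 1 := by simpa using hp
  obtain ⟨C, hC⟩ := ((tendsto_qPoch hr ((‖p‖ : ℝ) : ℂ)).inv₀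
    (qProd_ne_zero hr hr)).norm.bddAbove_range
  refine ⟨C, fun a ha k => le_trans ?_ (hC ⟨k, rfl⟩)⟩
  have hne := qPoch_ne_zero hr hr k
  simp only [norm_inv]
  refine inv_anti₀ (norm_pos_iff.mpr hne) ?_
  simp only [qPoch, norm_prod]
  refine prod_le_prod (fun _ _ => norm_nonneg _) fun i _ => ?_
  have hle : ‖a * p ^ i‖ ≤ ‖p‖ * ‖p‖ ^ i := by
    rw [norm_mul, norm_pow]
    gcongr
  have hlt : ‖p‖ * ‖p‖ ^ i ≤ 1 := by
    rw [← pow_succ']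
    exact pow_le_one₀ (norm_nonneg _) hp.le
  have : (1 - ((‖p‖ : ℝ) : ℂ) * ((‖p‖ : ℝ) : ℂ) ^ i) = ((1 - ‖p‖ * ‖p‖ ^ i : ℝ) : ℂ) := by
    push_cast; ring
  rw [this, Complex.norm_real, Real.norm_of_nonneg (by linarith)]
  have := norm_sub_norm_le (1 : ℂ) (a * p ^ i)
  rw [norm_one] at this
  linarith

/-! ### Telescoping series and the q-binomial theorem. -/

/-- The value of a telescoping sum. -/
lemma tsum_eq_of_telescoping {t G : ℕ → ℂ} {l : ℂ} (ht : Summable t)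
    (h : ∀ k, t k = G (k + 1) - G k) (hG : Tendsto G atTop (𝓝 l)) :
    ∑' k, t k = l - G 0 := by
  refine tendsto_nhds_unique ht.hasSum.tendsto_sum_nat ?_
  simp only [h, sum_range_sub]
  exact hG.sub_const _

/-- The terms of the `q`-binomial series. -/
def qBinTerm (a p x : ℂ) (k : ℕ) : ℂ := qPoch a p k / qPoch p p k * x ^ k

lemma exists_norm_qBinTerm_le {p : ℂ} (hp : ‖p‖ < 1) (a : ℂ) :
    ∃ C, ∀ x k, ‖qBinTerm a p x k‖ ≤ C * ‖x‖ ^ k := by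
  obtain ⟨C, hC⟩ := exists_norm_qPoch_le hp ‖a‖
  obtain ⟨D, hD⟩ := exists_norm_inv_qPoch_le hp
  refine ⟨C * D, fun x k => ?_⟩
  rw [qBinTerm, div_eq_mul_inv, norm_mul, norm_mul, norm_pow]
  have hC0 := (norm_nonneg _).trans (hC a le_rfl 0)
  gcongr
  · exact hC a le_rfl k
  · exact hD p le_rfl k

lemma summable_qBinTerm {p x : ℂ} (hp : ‖p‖ < 1) (hx : ‖x‖ < 1) (a : ℂ) :
    Summable (qBinTerm a p x) := by
  obtain ⟨C, hC⟩ := exists_norm_qBinTerm_le hp a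
  exact .of_norm_bounded ((summable_geometric_of_lt_one (norm_nonneg x) hx).mul_left C) (hC x)

lemma qBinTerm_succ {p : ℂ} (hp : ‖p‖ < 1) (a x : ℂ) (k : ℕ) :
    qBinTerm a p x (k + 1) * (1 - p ^ (k + 1)) = qBinTerm a p x k * (1 - a * p ^ k) * x := by
  have h1 := qPoch_ne_zero hp hp k
  have h2 := one_sub_ne_zero_of_norm_lt (norm_mul_pow_lt_one hp hp k)
  rw [qBinTerm, qBinTerm, qPoch_succ, qPoch_succ, pow_succ' p k, pow_succ x k]
  rw [mul_comm] at h2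
  generalize p ^ k = y at *
  field_simp

lemma qBinTerm_mul (a p x : ℂ) (k : ℕ) :
    qBinTerm a p (p * x) k = qBinTerm a p x k * p ^ k := by
  rw [qBinTerm, qBinTerm, mul_pow]
  ring

lemma norm_mul_lt_one {x y : ℂ} (hx : ‖x‖ < 1) (hy : ‖y‖ < 1) : ‖x * y‖ < 1 := by
  rw [norm_mul]
  exact mul_lt_one_of_nonneg_of_lt_one_left (norm_nonneg _) hx hy.le

/-- The difference of the two sides telescopes, by the term ratio `qBinTerm_succ`. Iterating the
relation peels off the factors of the product in `tsum_qBinTerm`. -/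
lemma one_sub_mul_tsum_qBinTerm {p x : ℂ} (hp : ‖p‖ < 1) (hx : ‖x‖ < 1) (a : ℂ) :
    (1 - x) * ∑' k, qBinTerm a p x k = (1 - a * x) * ∑' k, qBinTerm a p (p * x) k := by
  have s1 := summable_qBinTerm hp hx a
  have s2 := summable_qBinTerm hp (norm_mul_lt_one hp hx) a
  rw [← sub_eq_zero, ← tsum_mul_left, ← tsum_mul_left,
    ← (s1.mul_left _).tsum_sub (s2.mul_left _)]
  have key := tsum_eq_of_telescoping ((s1.mul_left (1 - x)).sub (s2.mul_left (1 - a * x)))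
    (G := fun k => -(qBinTerm a p x k * (1 - p ^ k))) (l := 0) (fun k => ?_) ?_
  · rw [key]
    simp
  · rw [qBinTerm_mul]
    rw [qBinTerm_succ hp]
    ring
  · have := s1.tendsto_atTop_zero.sub s2.tendsto_atTop_zero
    simp only [qBinTerm_mul] at this
    simpa [mul_sub] using this.neg

lemma tendsto_tsum_qBinTerm {p x : ℂ} (hp : ‖p‖ < 1) (hx : ‖x‖ < 1) (a : ℂ) :
    Tendsto (fun n : ℕ => ∑' k, qBinTerm a p (p ^ n * x) k) atTop (𝓝 1) := by
  obtain ⟨C, hC⟩ := exists_norm_qBinTerm_le hp a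
  have h0 : ∑' k, qBinTerm a p 0 k = 1 := by
    rw [tsum_eq_single 0 fun k hk => by simp [qBinTerm, hk]]
    simp [qBinTerm]
  have hC0 : 0 ≤ C := by simpa using (norm_nonneg _).trans (hC x 0)
  rw [← h0]
  refine tendsto_tsum_of_dominated_convergence
    ((summable_geometric_of_lt_one (norm_nonneg x) hx).mul_left C) (fun k => ?_)
    (.of_forall fun n k => (hC _ k).trans ?_)
  · have : Tendsto (fun n : ℕ => p ^ n * x) atTop (𝓝 0) := by
      simpa using (tendsto_pow_atTop_nhds_zero_of_norm_lt_one hp).mul_const x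
    exact (this.pow k).const_mul _
  · gcongr
    rw [norm_mul, norm_pow]
    exact mul_le_of_le_one_left (norm_nonneg _) (pow_le_one₀ (norm_nonneg _) hp.le)

/-- The `q`-binomial theorem. -/
theorem tsum_qBinTerm {p x : ℂ} (hp : ‖p‖ < 1) (hx : ‖x‖ < 1) (a : ℂ) :
    ∑' k, qBinTerm a p x k = qProd (a * x) p / qProd x p := by
  rw [eq_div_iff (qProd_ne_zero hp hx)]
  have hstep : ∀ n : ℕ, (∑' k, qBinTerm a p x k) * qPoch x p n =
      qPoch (a * x) p n * ∑' k, qBinTerm a p (p ^ n * x) k := by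
    intro n
    induction n with
    | zero => simp
    | succ n ih =>
      have h := one_sub_mul_tsum_qBinTerm hp
        (by simpa [mul_comm] using norm_mul_pow_lt_one hp hx n : ‖p ^ n * x‖ < 1) a
      rw [qPoch_succ, qPoch_succ, pow_succ', mul_assoc p, ← mul_assoc, ih, mul_assoc, mul_assoc]
      congr 1
      linear_combination h
  have h1 := ((tendsto_qPoch hp (a * x)).mul (tendsto_tsum_qBinTerm hp hx a)).congr
    fun n => (hstep n).symm
  simpa using tendsto_nhds_unique ((tendsto_qPoch hp x).const_mul _) h1

/-! ### Gauss's product for the triangular-number series. -/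

/-- Gauss's series `∑ q ^ (n (n + 1) / 2)`. -/
def psi (q : ℂ) : ℂ := ∑' n : ℕ, q ^ (n * (n + 1) / 2)

lemma summable_psi {q : ℂ} (hq : ‖q‖ < 1) : Summable fun n : ℕ => q ^ (n * (n + 1) / 2) := by
  refine .of_norm_bounded (summable_geometric_of_lt_one (norm_nonneg q) hq) fun n => ?_
  rw [norm_pow]
  refine pow_le_pow_of_le_one (norm_nonneg _) hq.le ?_
  rw [Nat.le_div_iff_mul_le two_pos]
  rcases n with _ | n
  · simp
  · gcongr
    omega

lemma norm_pow_lt_one {q : ℂ} (hq : ‖q‖ < 1) {m : ℕ} (hm : m ≠ 0) : ‖q ^ m‖ < 1 := by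
  rw [norm_pow]
  exact pow_lt_one₀ (norm_nonneg _) hq hm

/-- The partial products of `∏ (1 - q ^ (2 n)) / (1 - q ^ (2 n - 1))`. -/
def gaussProd (q : ℂ) (n : ℕ) : ℂ := qPoch (q ^ 2) (q ^ 2) n / qPoch q (q ^ 2) n

lemma gaussProd_ne_zero {q : ℂ} (hq : ‖q‖ < 1) (n : ℕ) : gaussProd q n ≠ 0 :=
  have h := norm_pow_lt_one hq two_ne_zero
  div_ne_zero (qPoch_ne_zero h h n) (qPoch_ne_zero h hq n)

lemma tendsto_gaussProd {q : ℂ} (hq : ‖q‖ < 1) :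
    Tendsto (gaussProd q) atTop (𝓝 (qProd (q ^ 2) (q ^ 2) / qProd q (q ^ 2))) :=
  have h := norm_pow_lt_one hq two_ne_zero
  (tendsto_qPoch h _).div (tendsto_qPoch h _) (qProd_ne_zero h hq)

lemma gaussProd_succ {q : ℂ} (hq : ‖q‖ < 1) (n : ℕ) :
    gaussProd q (n + 1) * (1 - q * q ^ (2 * n)) = gaussProd q n * (1 - q ^ 2 * q ^ (2 * n)) := by
  have h := norm_pow_lt_one hq two_ne_zero
  have h1 := one_sub_ne_zero_of_norm_lt (norm_mul_pow_lt_one h hq n)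
  have h2 := qPoch_ne_zero h hq n
  rw [gaussProd, gaussProd, qPoch_succ, qPoch_succ]
  rw [pow_mul]
  generalize (q ^ 2) ^ n = y at *
  field_simp

/-- Shanks's finite form of Gauss's identity. -/
lemma sum_gaussProd_div {q : ℂ} (hq : ‖q‖ < 1) (n : ℕ) :
    ∑ s ∈ range n, gaussProd q n / gaussProd q s * q ^ (s * (2 * n + 1)) =
      ∑ s ∈ range (2 * n), q ^ (s * (s + 1) / 2) := by
  induction n with
  | zero => simp
  | succ n ih =>
    have hP := gaussProd_ne_zero hq
    have hn : 1 - q * q ^ (2 * n) ≠ 0 := by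
      simpa [pow_mul] using
        one_sub_ne_zero_of_norm_lt (norm_mul_pow_lt_one (norm_pow_lt_one hq two_ne_zero) hq n)
    -- A telescoping certificate for the passage from n to n + 1. Since G 0 = 0, the sum grows by
    -- the old summand at s = n, which is q^(n(2n+1)), and by G (n+1) = q^((2n+1)(n+1)): the
    -- triangular powers of index 2n and 2n + 1.
    set G : ℕ → ℂ := fun s => (1 - q ^ (2 * s)) * (gaussProd q n / gaussProd q s) *
      q ^ (s * (2 * n + 1)) / (1 - q * q ^ (2 * n)) with hG
    have key : ∀ s, gaussProd q (n + 1) / gaussProd q s * q ^ (s * (2 * (n + 1) + 1)) =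
        gaussProd q n / gaussProd q s * q ^ (s * (2 * n + 1)) + (G (s + 1) - G s) := by
      intro s
      have e1 : gaussProd q (n + 1) =
          gaussProd q n * (1 - q ^ 2 * q ^ (2 * n)) / (1 - q * q ^ (2 * n)) := by
        rw [eq_div_iff hn, gaussProd_succ hq]
      have e2 : (1 - q ^ (2 * (s + 1))) / gaussProd q (s + 1) =
          (1 - q * q ^ (2 * s)) / gaussProd q s := by
        rw [div_eq_div_iff (hP _) (hP _), mul_comm _ (gaussProd q (s + 1)), gaussProd_succ hq]
        ring
      have e3 : G (s + 1) = (1 - q ^ (2 * (s + 1))) / gaussProd q (s + 1) * gaussProd q n *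
          q ^ ((s + 1) * (2 * n + 1)) / (1 - q * q ^ (2 * n)) := by
        rw [hG]
        ring
      rw [e3, e2, e1, hG]
      have e4 : q ^ (s * (2 * (n + 1) + 1)) = q ^ (s * (2 * n + 1)) * q ^ (2 * s) := by ring
      have e5 : q ^ ((s + 1) * (2 * n + 1)) = q ^ (s * (2 * n + 1)) * (q * q ^ (2 * n)) := by ring
      rw [e4, e5]
      have := hP s
      dsimp only
      generalize q ^ (s * (2 * n + 1)) = u at *
      generalize q ^ (2 * s) = v at *
      generalize q ^ (2 * n) = y at *
      field_simp
      ring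
    have hG0 : G 0 = 0 := by simp [hG]
    have hGn : G (n + 1) = q ^ ((2 * n + 1) * (n + 1)) := by
      rw [hG]
      dsimp only
      have e : gaussProd q n * (1 - q ^ (2 * (n + 1))) =
          gaussProd q (n + 1) * (1 - q * q ^ (2 * n)) := by
        rw [gaussProd_succ hq]
        ring
      have := hP (n + 1)
      rw [div_eq_iff hn, mul_div_assoc', mul_comm (1 - _), e]
      field_simp
      ring
    rw [sum_congr rfl fun s _ => key s, sum_add_distrib, sum_range_sub, hG0, sub_zero, hGn,
      sum_range_succ, ih, div_self (hP n), one_mul,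
      show 2 * (n + 1) = 2 * n + 1 + 1 by ring, sum_range_succ, sum_range_succ]
    congr 3
    · rw [mul_assoc, Nat.mul_div_cancel_left _ two_pos]
    · rw [show (2 * n + 1) * (2 * n + 1 + 1) = 2 * ((2 * n + 1) * (n + 1)) by ring,
        Nat.mul_div_cancel_left _ two_pos]

/-- Gauss's identity `∑ q ^ (n (n + 1) / 2) = (q² ; q²)_∞ / (q ; q²)_∞`. -/
theorem psi_eq {q : ℂ} (hq : ‖q‖ < 1) :
    psi q = qProd (q ^ 2) (q ^ 2) / qProd q (q ^ 2) := by
  obtain ⟨C, hC⟩ := (tendsto_gaussProd hq).norm.bddAbove_range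
  obtain ⟨D, hD⟩ := ((tendsto_gaussProd hq).inv₀ (div_ne_zero
    (qProd_ne_zero (norm_pow_lt_one hq two_ne_zero) (norm_pow_lt_one hq two_ne_zero))
    (qProd_ne_zero (norm_pow_lt_one hq two_ne_zero) hq))).norm.bddAbove_range
  have hC' : ∀ n, ‖gaussProd q n‖ ≤ C := fun n => hC ⟨n, rfl⟩
  have hD' : ∀ n, ‖(gaussProd q n)⁻¹‖ ≤ D := fun n => hD ⟨n, rfl⟩
  have hC0 : 0 ≤ C := (norm_nonneg _).trans (hC' 0)
  have hD0 : 0 ≤ D := (norm_nonneg _).trans (hD' 0)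
  -- The terms s ≥ 1 of Shanks's sum at n + 1. There are n of them, each at most C D |q|^n, so in
  -- the limit only the term s = 0, which is `gaussProd q (n + 1)`, survives.
  set R : ℕ → ℂ := fun n => ∑ s ∈ Finset.range n,
    gaussProd q (n + 1) / gaussProd q (s + 1) * q ^ ((s + 1) * (2 * (n + 1) + 1))
  have hR : Tendsto R atTop (𝓝 0) := by
    refine squeeze_zero_norm (a := fun n : ℕ => C * D * (n * ‖q‖ ^ n)) (fun n => ?_) ?_
    · have hb : ∀ s ∈ range n, ‖gaussProd q (n + 1) / gaussProd q (s + 1) *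
          q ^ ((s + 1) * (2 * (n + 1) + 1))‖ ≤ C * D * ‖q‖ ^ n := by
        intro s _
        rw [div_eq_mul_inv, norm_mul, norm_mul, norm_pow]
        exact mul_le_mul (mul_le_mul (hC' _) (hD' _) (norm_nonneg _) hC0)
          (pow_le_pow_of_le_one (norm_nonneg _) hq.le (by nlinarith)) (by positivity)
          (mul_nonneg hC0 hD0)
      refine (norm_sum_le_of_le (range n) hb).trans ?_
      rw [sum_const, card_range, nsmul_eq_mul]
      exact le_of_eq (by ring)
    · simpa using
        (tendsto_self_mul_const_pow_of_lt_one (norm_nonneg q) hq).const_mul (C * D)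
  have h1 : Tendsto (fun n => ∑ s ∈ range (2 * (n + 1)), q ^ (s * (s + 1) / 2)) atTop
      (𝓝 (psi q)) :=
    (summable_psi hq).hasSum.tendsto_sum_nat.comp
      ((tendsto_add_atTop_nat 1).const_mul_atTop' two_pos)
  refine tendsto_nhds_unique h1 ?_
  have h2 := hR.add ((tendsto_add_atTop_iff_nat 1).mpr (tendsto_gaussProd hq))
  rw [zero_add] at h2
  refine h2.congr fun n => ?_
  rw [← sum_gaussProd_div hq, sum_range_succ']
  simp [R, gaussProd]

/-! ### Cubic dissection and Ramanujan's identity. -/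

/-- The part of `psi q` whose exponents are divisible by three. -/
def psiThree (q : ℂ) : ℂ :=
  ∑' n : ℕ, if 3 ∣ n * (n + 1) / 2 then q ^ (n * (n + 1) / 2) else 0

/-- The `3`-dissection of `psi`. -/
lemma psi_eq_psiThree_add {q : ℂ} (hq : ‖q‖ < 1) : psi q = psiThree q + q * psi (q ^ 9) := by
  have hs := summable_psi hq
  have hs3 : Summable fun n : ℕ => if 3 ∣ n * (n + 1) / 2 then q ^ (n * (n + 1) / 2) else 0 := by
    refine hs.norm.of_norm_bounded fun n => ?_
    split_ifs <;> simp
  rw [← sub_eq_iff_eq_add', psi, psiThree, ← hs.tsum_sub hs3, psi, ← tsum_mul_left]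
  -- A triangular number T_n is prime to 3 exactly when n = 3k + 1, and then T_n = 9 T_k + 1.
  have hinj : Function.Injective fun k : ℕ => 3 * k + 1 := fun a b h => by
    simpa using h
  rw [← hinj.tsum_eq]
  · refine tsum_congr fun k => ?_
    have h2 : 2 ∣ k * (k + 1) := (Nat.even_mul_succ_self k).two_dvd
    have h : (3 * k + 1) * (3 * k + 1 + 1) / 2 = 9 * (k * (k + 1) / 2) + 1 := by
      have : (3 * k + 1) * (3 * k + 1 + 1) = 9 * (k * (k + 1)) + 2 := by ring
      omega
    rw [h, if_neg (by omega), sub_zero, pow_succ', pow_mul]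
  · intro n hn
    by_contra hk
    refine hn ?_
    have : n % 3 = 0 ∨ n % 3 = 2 := by
      by_contra h
      exact hk ⟨n / 3, by dsimp only; omega⟩
    have h3 : 3 ∣ n * (n + 1) := by
      rcases this with h | h
      · exact dvd_mul_of_dvd_left (Nat.dvd_of_mod_eq_zero h) _
      · exact dvd_mul_of_dvd_right (Nat.dvd_of_mod_eq_zero (by omega)) _
    have h2 : 2 ∣ n * (n + 1) := (Nat.even_mul_succ_self n).two_dvd
    simp [show 3 ∣ n * (n + 1) / 2 by omega]

lemma psiThree_mul {ω : ℂ} (hω : ω ^ 3 = 1) (q : ℂ) : psiThree (ω * q) = psiThree q := by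
  refine tsum_congr fun n => ?_
  split_ifs with h
  · obtain ⟨m, hm⟩ := h
    rw [hm, mul_pow, pow_mul ω, hω, one_pow, one_mul]
  · rfl

/-- The Euler product `∏ (1 - q ^ n)`. -/
def euler (q : ℂ) : ℂ := qProd q q

lemma euler_ne_zero {q : ℂ} (hq : ‖q‖ < 1) : euler q ≠ 0 := qProd_ne_zero hq hq

/-- By parity of the exponent, `euler q` is (q; q²)_∞ (q²; q²)_∞, which cancels the denominator in
Gauss's product. Products of `psi` thereby reduce to products of `euler`. -/
lemma psi_mul_euler {q : ℂ} (hq : ‖q‖ < 1) : psi q * euler q = euler (q ^ 2) ^ 2 := by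
  have h2 := norm_pow_lt_one hq two_ne_zero
  have h := qProd_ne_zero h2 hq
  rw [psi_eq hq, euler, qProd_eq_prod (m := 2) hq q two_pos, euler, prod_range_succ _ 1,
    prod_range_one]
  simp only [pow_zero, mul_one, pow_one, ← pow_two]
  field_simp

/-- Factor by factor this is (1 - x)(1 - ωx)(1 - ω²x) = 1 - x³. -/
lemma qProd_cube {p : ℂ} (hp : ‖p‖ < 1) {ω : ℂ} (hω : ω ^ 2 + ω + 1 = 0) (a : ℂ) :
    qProd a p * qProd (ω * a) p * qProd (ω ^ 2 * a) p = qProd (a ^ 3) (p ^ 3) := by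
  have hp3 := norm_pow_lt_one hp three_ne_zero
  refine tendsto_nhds_unique (((tendsto_qPoch hp a).mul (tendsto_qPoch hp (ω * a))).mul
    (tendsto_qPoch hp (ω ^ 2 * a))) ((tendsto_qPoch hp3 (a ^ 3)).congr fun n => ?_)
  rw [qPoch, qPoch, qPoch, qPoch, ← prod_mul_distrib, ← prod_mul_distrib]
  refine prod_congr rfl fun i _ => ?_
  have e : (p ^ 3) ^ i = (p ^ i) ^ 3 := by ring
  rw [e]
  generalize p ^ i = y
  linear_combination (-(a * y) ^ 2 * ω + a * y + (ω - 1) * (a * y) ^ 3) * hω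

/-- The product of the Euler products at the three cube roots of `q ^ 3`. -/
lemma euler_cube {q ω : ℂ} (hq : ‖q‖ < 1) (hω : ω ^ 2 + ω + 1 = 0) :
    euler q * euler (ω * q) * euler (ω ^ 2 * q) * euler (q ^ 9) = euler (q ^ 3) ^ 4 := by
  have hω3 : ω ^ 3 = 1 := by linear_combination (ω - 1) * hω
  have hn : ‖ω‖ = 1 := by
    have : ‖ω‖ ^ 3 = 1 := by rw [← norm_pow, hω3, norm_one]
    exact (pow_eq_one_iff_of_nonneg (norm_nonneg _) three_ne_zero).mp this
  have hq3 := norm_pow_lt_one hq three_ne_zero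
  have h1 : ‖ω * q‖ < 1 := by rwa [norm_mul, hn, one_mul]
  have h2 : ‖ω ^ 2 * q‖ < 1 := by rwa [norm_mul, norm_pow, hn, one_pow, one_mul]
  have e : ∀ x : ℂ, ‖x‖ < 1 → euler x =
      qProd x (x ^ 3) * qProd (x ^ 2) (x ^ 3) * qProd (x ^ 3) (x ^ 3) := fun x hx => by
    rw [euler, qProd_eq_prod (m := 3) hx x three_pos, prod_range_succ _ 2, prod_range_succ _ 1,
      prod_range_one]
    simp only [← pow_succ', zero_add, pow_one, Nat.reduceAdd]
    rw [pow_two]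
  have c1 : (ω * q) ^ 3 = q ^ 3 := by rw [mul_pow, hω3, one_mul]
  have c2 : (ω ^ 2 * q) ^ 3 = q ^ 3 := by
    rw [mul_pow, ← pow_mul, mul_comm 2 3, pow_mul, hω3, one_pow, one_mul]
  have c3 : (ω ^ 2 * q) ^ 2 = ω * q ^ 2 := by linear_combination ω * q ^ 2 * hω3
  have t1 := qProd_cube hq3 hω q
  have t2 := qProd_cube hq3 hω (q ^ 2)
  have t3 := e (q ^ 3) hq3
  have f : euler (q ^ 9) = qProd ((q ^ 3) ^ 3) ((q ^ 3) ^ 3) := by rw [euler]; ring_nf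
  have f' : (q ^ 2) ^ 3 = (q ^ 3) ^ 2 := by ring
  rw [f'] at t2
  rw [f, e q hq, e _ h1, e _ h2, c1, c2, c3, mul_pow ω q 2]
  -- Exponents divisible by 3 give `euler (q ^ 3)` three times; the classes 1 and 2 mod 3 combine,
  -- together with `euler (q ^ 9)`, into the fourth copy.
  calc _ = (qProd q (q ^ 3) * qProd (ω * q) (q ^ 3) * qProd (ω ^ 2 * q) (q ^ 3)) *
        (qProd (q ^ 2) (q ^ 3) * qProd (ω * q ^ 2) (q ^ 3) * qProd (ω ^ 2 * q ^ 2) (q ^ 3)) *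
        qProd ((q ^ 3) ^ 3) ((q ^ 3) ^ 3) * euler (q ^ 3) ^ 3 := by rw [euler]; ring
    _ = _ := by rw [t1, t2, ← t3]; ring

/-- The product of the three values of `psi` at the cube roots of `q ^ 3`. -/
lemma psi_cube {q ω : ℂ} (hq : ‖q‖ < 1) (hω : ω ^ 2 + ω + 1 = 0) :
    psi q * psi (ω * q) * psi (ω ^ 2 * q) * psi (q ^ 9) = psi (q ^ 3) ^ 4 := by
  have hω3 : ω ^ 3 = 1 := by linear_combination (ω - 1) * hω
  -- Squaring ωq replaces ω by ω², so `euler_cube` at q² is applied with this other primitive root.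
  have hω' : (ω ^ 2) ^ 2 + ω ^ 2 + 1 = 0 := by linear_combination hω + ω * hω3
  have hn : ‖ω‖ = 1 := by
    have : ‖ω‖ ^ 3 = 1 := by rw [← norm_pow, hω3, norm_one]
    exact (pow_eq_one_iff_of_nonneg (norm_nonneg _) three_ne_zero).mp this
  have hq' : ∀ {m : ℕ}, m ≠ 0 → ‖q ^ m‖ < 1 := fun hm => norm_pow_lt_one hq hm
  have p0 := psi_mul_euler hq
  have p1 := psi_mul_euler (q := ω * q) (by rwa [norm_mul, hn, one_mul])
  have p2 := psi_mul_euler (q := ω ^ 2 * q) (by rwa [norm_mul, norm_pow, hn, one_pow, one_mul])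
  have p3 := psi_mul_euler (hq' three_ne_zero)
  have p9 := psi_mul_euler (hq' (m := 9) (by norm_num))
  have c := euler_cube hq hω
  have c2 := euler_cube (hq' two_ne_zero) hω'
  have e1 : (ω ^ 2) ^ 2 * q ^ 2 = (ω ^ 2 * q) ^ 2 := by ring
  rw [e1, ← mul_pow ω, ← pow_mul q, ← pow_mul q, mul_comm 2 9, mul_comm 2 3, pow_mul q 9 2,
    pow_mul q 3 2] at c2
  have n3 := euler_ne_zero (hq' three_ne_zero)
  have n9 := euler_ne_zero (hq' (m := 9) (by norm_num))
  refine mul_right_cancel₀ (mul_ne_zero (pow_ne_zero 4 n3) n9) ?_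
  calc _ = (psi q * euler q) * (psi (ω * q) * euler (ω * q)) *
        (psi (ω ^ 2 * q) * euler (ω ^ 2 * q)) * (psi (q ^ 9) * euler (q ^ 9)) * euler (q ^ 9) := by
        rw [← c]; ring
    _ = (euler (q ^ 2) * euler ((ω * q) ^ 2) * euler ((ω ^ 2 * q) ^ 2) *
        euler ((q ^ 9) ^ 2)) ^ 2 * euler (q ^ 9) := by rw [p0, p1, p2, p9]; ring
    _ = ((euler ((q ^ 3) ^ 2)) ^ 2) ^ 4 * euler (q ^ 9) := by rw [c2]; ring
    _ = _ := by rw [← p3]; ring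

lemma psi_ne_zero {q : ℂ} (hq : ‖q‖ < 1) : psi q ≠ 0 := by
  intro h
  have := psi_mul_euler hq
  rw [h, zero_mul] at this
  exact pow_ne_zero 2 (euler_ne_zero (norm_pow_lt_one hq two_ne_zero)) this.symm

/-- Ramanujan's identity relating `psi q`, `psi (q ^ 3)` and `psi (q ^ 9)`. -/
theorem psi_pow_four {q : ℂ} (hq : ‖q‖ < 1) :
    psi (q ^ 3) ^ 4 = psi (q ^ 9) * psi q *
      (psi q ^ 2 - 3 * q * psi (q ^ 9) * psi q + 3 * q ^ 2 * psi (q ^ 9) ^ 2) := by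
  obtain ⟨ω, hω⟩ : ∃ ω : ℂ, ω ^ 2 + ω + 1 = 0 := by
    have hr := Complex.isPrimitiveRoot_exp 3 three_ne_zero
    have := hr.geom_sum_eq_zero (by norm_num)
    rw [sum_range_succ _ 2, sum_range_succ _ 1, sum_range_one, pow_zero, pow_one] at this
    exact ⟨_, by rw [← this]; ring⟩
  have hω3 : ω ^ 3 = 1 := by linear_combination (ω - 1) * hω
  have hn : ‖ω‖ = 1 := by
    have : ‖ω‖ ^ 3 = 1 := by rw [← norm_pow, hω3, norm_one]
    exact (pow_eq_one_iff_of_nonneg (norm_nonneg _) three_ne_zero).mp this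
  have h0 := psi_eq_psiThree_add hq
  have h1 := psi_eq_psiThree_add (q := ω * q) (by rwa [norm_mul, hn, one_mul])
  have h2 := psi_eq_psiThree_add (q := ω ^ 2 * q)
    (by rwa [norm_mul, norm_pow, hn, one_pow, one_mul])
  have e1 : (ω * q) ^ 9 = q ^ 9 := by
    rw [mul_pow, show (9 : ℕ) = 3 * 3 from rfl, pow_mul ω, hω3, one_pow, one_mul]
  have e2 : (ω ^ 2 * q) ^ 9 = q ^ 9 := by
    rw [mul_pow, ← pow_mul, show 2 * 9 = 3 * 6 from rfl, pow_mul ω, hω3, one_pow, one_mul]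
  rw [psiThree_mul hω3, e1] at h1
  rw [psiThree_mul (by rw [← pow_mul, mul_comm, pow_mul, hω3, one_pow]), e2] at h2
  -- With P = psi(q), B = psi(q⁹) and A = P - qB, the product of the three A + ω^j qB is A³ + q³B³ =
  -- P(P² - 3qBP + 3q²B²).
  rw [← psi_cube hq hω, h1, h2]
  have hA : psiThree q = psi q - q * psi (q ^ 9) := by rw [h0]; ring
  rw [hA]
  generalize psi q = P
  generalize psi (q ^ 9) = B
  linear_combination (B * P * (q * B * (P - q * B) + (ω - 1) * q ^ 2 * B ^ 2 +
    (P - q * B) * 0)) * hω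

/-! ### Continued fractions with a minimal solution. -/

lemma tendsto_zero_of_le_mul_add {d ε : ℕ → ℝ} {r : ℝ} (hr0 : 0 ≤ r) (hr : r < 1)
    (hd : ∀ n, 0 ≤ d n) (h : ∀ᶠ n in atTop, d (n + 1) ≤ r * d n + ε n)
    (hε : Tendsto ε atTop (𝓝 0)) : Tendsto d atTop (𝓝 0) := by
  rw [Metric.tendsto_atTop]
  intro δ hδ
  have hδ' : 0 < δ / 2 * (1 - r) := mul_pos (half_pos hδ) (sub_pos.mpr hr)
  obtain ⟨N, hN⟩ := eventually_atTop.mp (h.and (hε.eventually_lt_const hδ'))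
  have hind : ∀ k, d (N + k) ≤ r ^ k * d N + δ / 2 := by
    intro k
    induction k with
    | zero => simpa using (half_pos hδ).le
    | succ k ih =>
      obtain ⟨h1, h2⟩ := hN (N + k) (Nat.le_add_right _ _)
      have := mul_le_mul_of_nonneg_left ih hr0
      calc d (N + (k + 1)) ≤ r * d (N + k) + ε (N + k) := h1
        _ ≤ r * (r ^ k * d N + δ / 2) + δ / 2 * (1 - r) := by linarith
        _ = _ := by ring
  have hgeo : Tendsto (fun k => r ^ k * d N) atTop (𝓝 0) := by
    simpa using (tendsto_pow_atTop_nhds_zero_of_lt_one hr0 hr).mul_const (d N)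
  obtain ⟨K, hK⟩ := eventually_atTop.mp (hgeo.eventually_lt_const (half_pos hδ))
  refine ⟨N + K, fun n hn => ?_⟩
  have h1 := hind (n - N)
  have h2 := hK (n - N) (by omega)
  rw [Nat.add_sub_cancel' (by omega)] at h1
  rw [Real.dist_eq, sub_zero, abs_of_nonneg (hd n)]
  linarith

/-- A perturbed contractive affine recursion converges to the fixed point of its limit. -/
lemma tendsto_of_affine_recursion {e s : ℕ → ℂ} {σ : ℂ} (hσ : ‖σ‖ < 1)
    (hs : Tendsto s atTop (𝓝 σ)) (he : ∀ᶠ n in atTop, e (n + 1) = 1 + s n * e n) :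
    Tendsto e atTop (𝓝 (1 - σ)⁻¹) := by
  obtain ⟨r, hr1, hr2⟩ := exists_between hσ
  have h0 := one_sub_ne_zero_of_norm_lt hσ
  rw [tendsto_iff_norm_sub_tendsto_zero]
  refine tendsto_zero_of_le_mul_add (ε := fun n => ‖(s n - σ) * (1 - σ)⁻¹‖)
    ((norm_nonneg _).trans hr1.le) hr2 (fun _ => norm_nonneg _) ?_ ?_
  · filter_upwards [he, hs.norm.eventually_lt_const hr1] with n h1 h2
    have : e (n + 1) - (1 - σ)⁻¹ = s n * (e n - (1 - σ)⁻¹) + (s n - σ) * (1 - σ)⁻¹ := by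
      rw [h1]
      field_simp
      ring
    rw [this]
    refine (norm_add_le _ _).trans ?_
    rw [norm_mul (s n)]
    gcongr
  · simpa using ((hs.sub_const σ).mul_const (1 - σ)⁻¹).norm

/-- A form of Pincherle's theorem: a solution `M` of the three-term recurrence of a continued
fraction that is dominated in a quantitative way yields the value of the continued fraction. -/
theorem tendsto_convs_of_minimal {g : GenContFract ℂ} {a b M : ℕ → ℂ} {σ : ℂ}
    (hg : ∀ n, g.s.get? n = some ⟨a n, b n⟩) (ha : ∀ n, a n ≠ 0)
    (hM : ∀ n, M (n + 2) = b n * M (n + 1) + a n * M n) (hM0 : M 0 ≠ 0)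
    (hMne : ∀ᶠ n in atTop, M n ≠ 0) (hσ : ‖σ‖ < 1)
    (hlim : Tendsto (fun n => M (n + 2) / (-a n * M n)) atTop (𝓝 σ)) :
    Tendsto (fun n => g.convs n) atTop (𝓝 (g.h - M 1 / M 0)) := by
  -- `contsAux` starts one step early, at (1, 0), so the n-th convergent is A (n+1) / B (n+1).
  set A : ℕ → ℂ := fun n => (g.contsAux n).a
  set B : ℕ → ℂ := fun n => (g.contsAux n).b
  have hA : ∀ n, A (n + 2) = b n * A (n + 1) + a n * A n := fun n =>
    congrArg GenContFract.Pair.a (GenContFract.contsAux_recurrence (hg n) rfl rfl)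
  have hB : ∀ n, B (n + 2) = b n * B (n + 1) + a n * B n := fun n =>
    congrArg GenContFract.Pair.b (GenContFract.contsAux_recurrence (hg n) rfl rfl)
  have hA0 : A 0 = 1 := rfl
  have hA1 : A 1 = g.h := rfl
  have hB0 : B 0 = 0 := rfl
  have hB1 : B 1 = 1 := rfl
  -- Both sides solve the same recurrence with the same two initial values. Hence the error of the
  -- n-th convergent is M (n+1) / (M 0 * B (n+1)).
  have hlin : ∀ n, A n - (g.h - M 1 / M 0) * B n = M n / M 0 ∧
      A (n + 1) - (g.h - M 1 / M 0) * B (n + 1) = M (n + 1) / M 0 := by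
    intro n
    induction n with
    | zero =>
      rw [hA0, hB0, zero_add, hA1, hB1, div_self hM0]
      constructor <;> ring
    | succ n ih =>
      refine ⟨ih.2, ?_⟩
      rw [hA, hB, hM, add_div, mul_div_assoc, mul_div_assoc, ← ih.1, ← ih.2]
      ring
  set Δ : ℕ → ℂ := fun n => B (n + 1) * M n - B n * M (n + 1) with hΔ
  have hΔs : ∀ n, Δ (n + 1) = -a n * Δ n := by
    intro n
    simp only [hΔ]
    rw [hB, hM]
    ring
  have hΔne : ∀ n, Δ n ≠ 0 := by
    intro n
    induction n with
    | zero => simpa [hΔ, hB0, hB1] using hM0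
    | succ n ih =>
      rw [hΔs]
      exact mul_ne_zero (neg_ne_zero.mpr (ha n)) ih
  -- Normalised by the Casoratian Δ, e satisfies e (n+1) = 1 + s n * e n with s n → σ, so it has a
  -- nonzero limit; in particular B (n+1) ≠ 0 eventually. The ratios of u tend to σ, so u → 0, and u
  -- / e is M (n+1) / B (n+1).
  set e : ℕ → ℂ := fun n => B (n + 1) * M n / Δ n with he
  set u : ℕ → ℂ := fun n => M n * M (n + 1) / Δ n with hu
  have hel : Tendsto e atTop (𝓝 (1 - σ)⁻¹) := by
    refine tendsto_of_affine_recursion hσ hlim ?_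
    filter_upwards [hMne] with n hn
    have h1 := hΔne n
    have h2 := ha n
    have h3 := hΔne (n + 1)
    have h4 : B (n + 2) * M (n + 1) = Δ (n + 1) + B (n + 1) * M (n + 2) := by
      simp only [hΔ]
      ring
    simp only [he]
    rw [h4, add_div, div_self h3, hΔs]
    field_simp
  have hul : Tendsto u atTop (𝓝 0) := by
    obtain ⟨r, hr1, hr2⟩ := exists_between hσ
    refine (summable_of_ratio_norm_eventually_le (r := r) hr2 ?_).tendsto_atTop_zero
    filter_upwards [hMne, hlim.norm.eventually_lt_const hr1] with n hn h
    have h1 := hΔne n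
    have h2 := ha n
    have : u (n + 1) = M (n + 2) / (-a n * M n) * u n := by
      simp only [hu]
      rw [hΔs]
      field_simp
    rw [this, norm_mul]
    gcongr
  have hlim0 : Tendsto (fun n => u n / e n / M 0) atTop (𝓝 0) := by
    simpa using (hul.div hel (inv_ne_zero (one_sub_ne_zero_of_norm_lt hσ))).div_const (M 0)
  rw [← tendsto_sub_nhds_zero_iff]
  refine hlim0.congr' ?_
  filter_upwards [hMne, hel.eventually_ne (inv_ne_zero (one_sub_ne_zero_of_norm_lt hσ))]
    with n hn hen
  have hBn : B (n + 1) ≠ 0 := by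
    intro h
    simp [he, h] at hen
  have hconv : g.convs n = A (n + 1) / B (n + 1) := rfl
  have h1 := hΔne n
  have h2 := (hlin n).2
  rw [hconv]
  have h3 : u n / e n = M (n + 1) / B (n + 1) := by
    simp only [hu, he]
    field_simp
  rw [h3, div_right_comm, ← h2, sub_div, mul_div_assoc, div_self hBn, mul_one]

/-! ### The basic hypergeometric series behind the continued fraction. -/

lemma one_sub_mul_qPoch (a p : ℂ) (k : ℕ) :
    (1 - a) * qPoch (a * p) p k = qPoch a p k * (1 - a * p ^ k) := by
  rw [← qPoch_succ', qPoch_succ]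

lemma qPoch_mul_qPoch_neg (a p : ℂ) (k : ℕ) :
    qPoch a p k * qPoch (-a) p k = qPoch (a ^ 2) (p ^ 2) k := by
  rw [qPoch, qPoch, qPoch, ← prod_mul_distrib]
  refine prod_congr rfl fun i _ => ?_
  rw [← pow_mul, mul_comm 2, pow_mul]
  ring

/-- The terms of the basic hypergeometric series `cfSeries`. -/
def cfTerm (h z : ℂ) (k : ℕ) : ℂ :=
  qPoch (-h ^ 7) (h ^ 6) k * qPoch (h ^ 7 * z) (h ^ 6) k /
    (qPoch (h ^ 6) (h ^ 6) k * qPoch (-(h ^ 6 * z)) (h ^ 6) k) * (h ^ 2) ^ k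

/-- A basic hypergeometric series of base `h ^ 6` describing the tails of the continued
fraction, with `h ^ 2` the nome. -/
def cfSeries (h z : ℂ) : ℂ := ∑' k, cfTerm h z k

lemma norm_mul_lt_one_of_le {x y : ℂ} (hx : ‖x‖ < 1) (hy : ‖y‖ ≤ 1) : ‖x * y‖ < 1 := by
  rw [norm_mul]
  exact mul_lt_one_of_nonneg_of_lt_one_left (norm_nonneg _) hx hy

lemma norm_pow_le_one {h : ℂ} (hh : ‖h‖ < 1) (n : ℕ) : ‖h ^ n‖ ≤ 1 := by
  rw [norm_pow]
  exact pow_le_one₀ (norm_nonneg _) hh.le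

lemma norm_mul_le_one {x y : ℂ} (hx : ‖x‖ ≤ 1) (hy : ‖y‖ ≤ 1) : ‖x * y‖ ≤ 1 := by
  rw [norm_mul]
  exact mul_le_one₀ hx (norm_nonneg _) hy

lemma one_sub_pow_mul_ne_zero {h y : ℂ} (hh : ‖h‖ < 1) (hy : ‖y‖ ≤ 1) {m : ℕ} (hm : m ≠ 0) :
    1 - h ^ m * y ≠ 0 :=
  one_sub_ne_zero_of_norm_lt (norm_mul_lt_one_of_le (norm_pow_lt_one hh hm) hy)

lemma one_add_pow_mul_ne_zero {h y : ℂ} (hh : ‖h‖ < 1) (hy : ‖y‖ ≤ 1) {m : ℕ} (hm : m ≠ 0) :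
    1 + h ^ m * y ≠ 0 := by
  simpa using one_sub_pow_mul_ne_zero hh (y := -y) (by simpa using hy) hm

lemma exists_norm_cfTerm_le {h : ℂ} (hh : ‖h‖ < 1) :
    ∃ C, ∀ z : ℂ, ‖z‖ ≤ 1 → ∀ k, ‖cfTerm h z k‖ ≤ C * ‖h ^ 2‖ ^ k := by
  have hp : ‖h ^ 6‖ < 1 := norm_pow_lt_one hh (by norm_num)
  have h7 : ‖h ^ 7‖ ≤ 1 := norm_pow_le_one hh 7
  obtain ⟨C, hC⟩ := exists_norm_qPoch_le hp 1
  obtain ⟨D, hD⟩ := exists_norm_inv_qPoch_le hp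
  have hC0 := (norm_nonneg _).trans (hC 0 (by simp) 0)
  have hD0 := (norm_nonneg _).trans (hD (h ^ 6) le_rfl 0)
  refine ⟨C * C * (D * D), fun z hz k => ?_⟩
  have h1 := hC (-h ^ 7) (by simpa using h7) k
  have h2 := hC (h ^ 7 * z) (norm_mul_le_one h7 hz) k
  have h3 := hD (h ^ 6) le_rfl k
  have h4 := hD (-(h ^ 6 * z)) (by
    rw [norm_neg, norm_mul]
    exact mul_le_of_le_one_right (norm_nonneg _) hz) k
  rw [cfTerm, div_eq_mul_inv, mul_inv]
  simp only [norm_mul]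
  rw [norm_pow _ k]
  exact mul_le_mul_of_nonneg_right (mul_le_mul
    (mul_le_mul h1 h2 (norm_nonneg _) hC0) (mul_le_mul h3 h4 (norm_nonneg _) hD0)
    (by positivity) (by positivity)) (by positivity)

lemma summable_cfTerm {h z : ℂ} (hh : ‖h‖ < 1) (hz : ‖z‖ ≤ 1) : Summable (cfTerm h z) := by
  obtain ⟨C, hC⟩ := exists_norm_cfTerm_le hh
  exact .of_norm_bounded ((summable_geometric_of_lt_one (norm_nonneg _)
    (norm_pow_lt_one hh two_ne_zero)).mul_left C) (hC z hz)

lemma tendsto_cfSeries {h : ℂ} (hh : ‖h‖ < 1) :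
    Tendsto (fun n : ℕ => cfSeries h ((h ^ 6) ^ n)) atTop (𝓝 (cfSeries h 0)) := by
  have hp : ‖h ^ 6‖ < 1 := norm_pow_lt_one hh (by norm_num)
  obtain ⟨C, hC⟩ := exists_norm_cfTerm_le hh
  refine tendsto_tsum_of_dominated_convergence ((summable_geometric_of_lt_one (norm_nonneg _)
    (norm_pow_lt_one hh two_ne_zero)).mul_left C) (fun k => ?_)
    (.of_forall fun n k => hC _ (norm_pow_le_one hp n) k)
  have hcont : ContinuousAt (fun z => cfTerm h z k) 0 := by
    unfold cfTerm qPoch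
    refine ContinuousAt.mul (ContinuousAt.div (by fun_prop) (by fun_prop) ?_) (by fun_prop)
    exact mul_ne_zero (qPoch_ne_zero hp hp k) (qPoch_ne_zero hp (by simp) k)
  exact hcont.tendsto.comp (tendsto_pow_atTop_nhds_zero_of_norm_lt_one hp)

/-- At z = 0 the q-binomial theorem gives a nonvanishing product. This makes successive values of
`cfSeries` along z = h^(6n) have ratio tending to 1. -/
lemma cfSeries_zero_ne_zero {h : ℂ} (hh : ‖h‖ < 1) : cfSeries h 0 ≠ 0 := by
  have hp : ‖h ^ 6‖ < 1 := norm_pow_lt_one hh (by norm_num)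
  have h2 : ‖h ^ 2‖ < 1 := norm_pow_lt_one hh two_ne_zero
  have : cfSeries h 0 = ∑' k, qBinTerm (-h ^ 7) (h ^ 6) (h ^ 2) k := by
    refine tsum_congr fun k => ?_
    simp [cfTerm, qBinTerm, qPoch]
  rw [this, tsum_qBinTerm hp h2]
  refine div_ne_zero (qProd_ne_zero hp ?_) (qProd_ne_zero hp h2)
  rw [neg_mul, norm_neg, ← pow_add]
  exact norm_pow_lt_one hh (by norm_num)

lemma cfTerm_succ (h z : ℂ) (k : ℕ) :
    cfTerm h z (k + 1) = cfTerm h z k * ((1 + h ^ 7 * (h ^ 6) ^ k) *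
      (1 - h ^ 7 * (z * (h ^ 6) ^ k)) * h ^ 2) /
      ((1 - h ^ 6 * (h ^ 6) ^ k) * (1 + h ^ 6 * (z * (h ^ 6) ^ k))) := by
  rw [cfTerm, cfTerm, qPoch_succ, qPoch_succ, qPoch_succ, qPoch_succ, pow_succ (h ^ 2) k]
  simp only [neg_mul, sub_neg_eq_add, mul_assoc, div_eq_mul_inv, mul_inv]
  ring

/-- The effect of `z ↦ h ^ 6 z` on the terms of `cfSeries`. -/
lemma cfTerm_mul {h z : ℂ} (hh : ‖h‖ < 1) (hz : ‖z‖ ≤ 1) (k : ℕ) :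
    cfTerm h (z * h ^ 6) k = cfTerm h z k * ((1 - h ^ 7 * (z * (h ^ 6) ^ k)) * (1 + h ^ 6 * z)) /
      ((1 - h ^ 7 * z) * (1 + h ^ 6 * (z * (h ^ 6) ^ k))) := by
  have hp : ‖h ^ 6‖ < 1 := norm_pow_lt_one hh (by norm_num)
  have hpk := norm_pow_le_one hp k
  have n1 := one_sub_pow_mul_ne_zero hh hz (m := 7) (by norm_num)
  have n2 := one_add_pow_mul_ne_zero hh (norm_mul_le_one hz hpk) (m := 6) (by norm_num)
  have n3 := one_add_pow_mul_ne_zero hh hz (m := 6) (by norm_num)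
  have e1 : qPoch (h ^ 7 * (z * h ^ 6)) (h ^ 6) k =
      qPoch (h ^ 7 * z) (h ^ 6) k * (1 - h ^ 7 * (z * (h ^ 6) ^ k)) / (1 - h ^ 7 * z) := by
    rw [eq_div_iff n1, mul_comm, ← mul_assoc, one_sub_mul_qPoch, mul_assoc (h ^ 7)]
  have e2 : qPoch (-(h ^ 6 * (z * h ^ 6))) (h ^ 6) k =
      qPoch (-(h ^ 6 * z)) (h ^ 6) k * (1 + h ^ 6 * (z * (h ^ 6) ^ k)) / (1 + h ^ 6 * z) := by
    have := one_sub_mul_qPoch (-(h ^ 6 * z)) (h ^ 6) k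
    simp only [neg_mul, sub_neg_eq_add, mul_assoc] at this
    rw [eq_div_iff n3, mul_comm, this]
  rw [cfTerm, cfTerm, e1, e2]
  simp only [div_eq_mul_inv, mul_inv, inv_inv]
  ring

/-- The contiguous relation for `cfSeries` behind the continued fraction. -/
lemma cfSeries_recurrence {h z : ℂ} (hh : ‖h‖ < 1) (hz : ‖z‖ ≤ 1) :
    (1 + h ^ 6 * z) * (1 + h ^ 12 * z) *
        (cfSeries h z - (1 - h ^ 3) * cfSeries h (z * h ^ 6)) =
      h ^ 3 * (1 - h ^ 5 * z) * (1 - h ^ 13 * z) * cfSeries h (z * h ^ 6 * h ^ 6) := by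
  have hp : ‖h ^ 6‖ < 1 := norm_pow_lt_one hh (by norm_num)
  have hz1 : ‖z * h ^ 6‖ ≤ 1 := norm_mul_le_one hz hp.le
  have hz2 : ‖z * h ^ 6 * h ^ 6‖ ≤ 1 := norm_mul_le_one hz1 hp.le
  have s0 := summable_cfTerm hh hz
  have s1 := summable_cfTerm hh hz1
  have s2 := summable_cfTerm hh hz2
  have s := ((s0.sub (s1.mul_left (1 - h ^ 3))).mul_left
    ((1 + h ^ 6 * z) * (1 + h ^ 12 * z))).sub
    (s2.mul_left (h ^ 3 * (1 - h ^ 5 * z) * (1 - h ^ 13 * z)))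
  -- The factor 1 - (h⁶)^k kills the certificate at k = 0 and summability kills it at infinity, so
  -- the whole series sums to zero.
  have key := tsum_eq_of_telescoping s (l := 0) (G := fun k => (1 + h ^ 12 * z) *
    (1 - (h ^ 6) ^ k) * (z * h ^ 6 * (1 + h)) / (1 - h ^ 7 * (z * (h ^ 6) ^ k)) *
    cfTerm h (z * h ^ 6) k) (fun k => ?_) ?_
  · rw [(((s0.sub (s1.mul_left _)).mul_left _).tsum_sub (s2.mul_left _)), tsum_mul_left,
      tsum_mul_left, s0.tsum_sub (s1.mul_left _), tsum_mul_left] at key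
    simpa [sub_eq_zero, cfSeries] using key
  · have hx := norm_pow_le_one hp k
    rw [cfTerm_succ, cfTerm_mul hh hz1, cfTerm_mul hh hz]
    rw [pow_succ (h ^ 6) k]
    generalize (h ^ 6) ^ k = x at hx ⊢
    generalize cfTerm h z k = u
    have hzx := norm_mul_le_one hz hx
    have n1 := one_sub_pow_mul_ne_zero hh hz (m := 7) (by norm_num)
    have n2 := one_add_pow_mul_ne_zero hh hzx (m := 6) (by norm_num)
    have n3 := one_sub_pow_mul_ne_zero hh hz (m := 13) (by norm_num)
    have n4 := one_add_pow_mul_ne_zero hh hzx (m := 12) (by norm_num)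
    have n5 := one_sub_pow_mul_ne_zero hh hzx (m := 7) (by norm_num)
    have n6 := one_sub_pow_mul_ne_zero hh hx (m := 6) (by norm_num)
    have n7 := one_sub_pow_mul_ne_zero hh hzx (m := 13) (by norm_num)
    have c1 : h ^ 7 * (z * h ^ 6) = h ^ 13 * z := by ring
    have c2 : h ^ 7 * (z * h ^ 6 * x) = h ^ 13 * (z * x) := by ring
    have c3 : h ^ 6 * (z * h ^ 6 * x) = h ^ 12 * (z * x) := by ring
    have c4 : h ^ 6 * (z * h ^ 6) = h ^ 12 * z := by ring
    have c5 : h ^ 7 * (z * (x * h ^ 6)) = h ^ 13 * (z * x) := by ring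
    rw [c1, c2, c3, c4, c5]
    obtain ⟨d1, e1⟩ : ∃ d, d = 1 - h ^ 7 * z := ⟨_, rfl⟩
    obtain ⟨d2, e2⟩ : ∃ d, d = 1 + h ^ 6 * (z * x) := ⟨_, rfl⟩
    obtain ⟨d3, e3⟩ : ∃ d, d = 1 - h ^ 13 * z := ⟨_, rfl⟩
    obtain ⟨d4, e4⟩ : ∃ d, d = 1 + h ^ 12 * (z * x) := ⟨_, rfl⟩
    obtain ⟨d5, e5⟩ : ∃ d, d = 1 - h ^ 7 * (z * x) := ⟨_, rfl⟩
    obtain ⟨d6, e6⟩ : ∃ d, d = 1 - h ^ 6 * x := ⟨_, rfl⟩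
    obtain ⟨d7, e7⟩ : ∃ d, d = 1 - h ^ 13 * (z * x) := ⟨_, rfl⟩
    rw [← e1] at n1
    rw [← e2] at n2
    rw [← e3] at n3
    rw [← e4] at n4
    rw [← e5] at n5
    rw [← e6] at n6
    rw [← e7] at n7
    rw [← e1, ← e2, ← e3, ← e4, ← e5, ← e7, show 1 - x * h ^ 6 = d6 by rw [e6]; ring, ← e6]
    field_simp
    rw [e1, e2, e4, e5, e7]
    ring
  · have h0 := tendsto_pow_atTop_nhds_zero_of_norm_lt_one hp
    have h1 : Tendsto (fun k : ℕ => (1 + h ^ 12 * z) * (1 - (h ^ 6) ^ k) * (z * h ^ 6 * (1 + h)) /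
        (1 - h ^ 7 * (z * (h ^ 6) ^ k))) atTop
        (𝓝 ((1 + h ^ 12 * z) * (1 - 0) * (z * h ^ 6 * (1 + h)) / (1 - h ^ 7 * (z * 0)))) := by
      refine Tendsto.div ?_ ?_ (by simp)
      · exact ((h0.const_sub 1).const_mul _).mul_const _
      · exact ((h0.const_mul z).const_mul _).const_sub 1
    simpa using h1.mul s1.tendsto_atTop_zero

/-- At z = 1 the parameters pair up as ±h⁷ and ±h⁶, and (a; p)_k (-a; p)_k = (a²; p²)_k. -/
lemma cfTerm_one {h : ℂ} (k : ℕ) : cfTerm h 1 k = qBinTerm (h ^ 14) (h ^ 12) (h ^ 2) k := by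
  rw [cfTerm, qBinTerm, mul_one, mul_one, mul_comm (qPoch (-h ^ 7) _ _), qPoch_mul_qPoch_neg,
    qPoch_mul_qPoch_neg, ← pow_mul, ← pow_mul]

lemma cfSeries_one {h : ℂ} (hh : ‖h‖ < 1) :
    cfSeries h 1 = qProd (h ^ 16) (h ^ 12) / qProd (h ^ 2) (h ^ 12) := by
  rw [cfSeries, tsum_congr cfTerm_one, tsum_qBinTerm (norm_pow_lt_one hh (by norm_num))
    (norm_pow_lt_one hh two_ne_zero), ← pow_add]

/-- The left side is -h³ `cfSeries h 1` times the value `g.h - M 1 / M 0` of the continued fraction.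
Up to a telescoping sum it is the q-binomial series with a = h², x = h⁸ and base h¹². -/
lemma cfSeries_combination {h : ℂ} (hh : ‖h‖ < 1) :
    (1 - h ^ 3) * cfSeries h 1 +
        (h ^ 3 - h ^ 2) * (1 - h ^ 7) / (1 + h ^ 6) * cfSeries h (h ^ 6) =
      qProd (h ^ 10) (h ^ 12) / qProd (h ^ 8) (h ^ 12) := by
  have hp : ‖h ^ 6‖ < 1 := norm_pow_lt_one hh (by norm_num)
  have hpp : ‖h ^ 12‖ < 1 := norm_pow_lt_one hh (by norm_num)
  have h8 : ‖h ^ 8‖ < 1 := norm_pow_lt_one hh (by norm_num)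
  have hone : ‖(1 : ℂ)‖ ≤ 1 := norm_one.le
  have s0 := summable_cfTerm hh hone
  have s1 := summable_cfTerm hh hp.le
  have s2 := summable_qBinTerm hpp h8 (h ^ 2)
  have s := ((s0.mul_left (1 - h ^ 3)).add
    (s1.mul_left ((h ^ 3 - h ^ 2) * (1 - h ^ 7) / (1 + h ^ 6)))).sub s2
  have key := tsum_eq_of_telescoping s (l := 0) (G := fun k => -((1 - (h ^ 6) ^ k) *
    (1 + h ^ 2 * (h ^ 6) ^ k) / (1 - h ^ 2 * ((h ^ 6) ^ k) ^ 2) * cfTerm h 1 k))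
    (fun k => ?_) ?_
  · rw [((s0.mul_left _).add (s1.mul_left _)).tsum_sub s2,
      (s0.mul_left _).tsum_add (s1.mul_left _), tsum_mul_left, tsum_mul_left,
      tsum_qBinTerm hpp h8, ← pow_add] at key
    simpa [sub_eq_zero, cfSeries] using key
  · have hx := norm_pow_le_one hp k
    have h2k : ((h ^ 6) ^ k) ^ 2 = (h ^ 12) ^ k := by ring
    have e1 := cfTerm_mul hh hone k
    have e2 := cfTerm_succ h 1 k
    have n0 : (1 : ℂ) - h ^ 2 ≠ 0 := one_sub_ne_zero_of_norm_lt (norm_pow_lt_one hh two_ne_zero)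
    have hx2 : ‖((h ^ 6) ^ k) ^ 2‖ ≤ 1 := norm_pow (((h ^ 6) ^ k)) 2 ▸
      pow_le_one₀ (norm_nonneg _) hx
    have n1 := one_sub_pow_mul_ne_zero hh hx2 (m := 2) (by norm_num)
    have e3 : qBinTerm (h ^ 2) (h ^ 12) (h ^ 8) k =
        cfTerm h 1 k * ((1 - h ^ 2) * (h ^ 6) ^ k) / (1 - h ^ 2 * ((h ^ 6) ^ k) ^ 2) := by
      rw [eq_div_iff n1, cfTerm_one, qBinTerm, qBinTerm, h2k]
      have := one_sub_mul_qPoch (h ^ 2) (h ^ 12) k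
      rw [← pow_add] at this
      have e : (h ^ 8) ^ k = (h ^ 2) ^ k * (h ^ 6) ^ k := by ring
      rw [e]
      simp only [div_eq_mul_inv]
      linear_combination -((qPoch (h ^ 12) (h ^ 12) k)⁻¹ * (h ^ 2) ^ k * (h ^ 6) ^ k) * this
    rw [one_mul] at e1
    simp only [one_mul, mul_one] at e1 e2
    rw [e1, e2, e3, pow_succ (h ^ 6) k]
    generalize (h ^ 6) ^ k = x at hx hx2 n1 ⊢
    generalize cfTerm h 1 k = u
    have n2 := one_sub_pow_mul_ne_zero hh hx2 (m := 14) (by norm_num)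
    have n3 := one_add_pow_mul_ne_zero hh hx (m := 6) (by norm_num)
    have n4 := one_sub_pow_mul_ne_zero hh hx (m := 6) (by norm_num)
    have n5 := one_sub_pow_mul_ne_zero hh hone (m := 7) (by norm_num)
    have n6 := one_add_pow_mul_ne_zero hh hone (m := 6) (by norm_num)
    rw [mul_one] at n5 n6
    have c1 : h ^ 2 * (x * h ^ 6) ^ 2 = h ^ 14 * x ^ 2 := by ring
    rw [c1]
    field_simp
    ring
  · have h0 := tendsto_pow_atTop_nhds_zero_of_norm_lt_one hp
    have h1 : Tendsto (fun k : ℕ => (1 - (h ^ 6) ^ k) * (1 + h ^ 2 * (h ^ 6) ^ k) /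
        (1 - h ^ 2 * ((h ^ 6) ^ k) ^ 2)) atTop
        (𝓝 ((1 - 0) * (1 + h ^ 2 * 0) / (1 - h ^ 2 * 0 ^ 2))) := by
      refine Tendsto.div ?_ ?_ (by simp)
      · exact (h0.const_sub 1).mul ((h0.const_mul _).const_add 1)
      · exact ((h0.pow 2).const_mul _).const_sub 1
    simpa using (h1.mul s0.tendsto_atTop_zero).neg

/-! ### Evaluation of the continued fraction. -/

lemma one_sub_inv_mul_pow_ne_zero {h : ℂ} (hh : ‖h‖ < 1) (h0 : h ≠ 0) (n : ℕ) :
    1 - h⁻¹ * (h ^ 6) ^ n ≠ 0 := by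
  intro H
  have e : h = (h ^ 6) ^ n := by
    field_simp at H
    linear_combination H
  rcases n with _ | n
  · rw [pow_zero] at e
    simp [e] at hh
  · have h1 : h ^ (6 * n + 5) = 1 := by
      refine mul_right_cancel₀ h0 ?_
      rw [one_mul]
      nth_rewrite 3 [e]
      ring
    have h2 := norm_pow_lt_one hh (m := 6 * n + 5) (by omega)
    simp [h1] at h2

/-- The value of the continued fraction of order six. -/
lemma tendsto_convs_orderSix {h : ℂ} (hh : ‖h‖ < 1) (h0 : h ≠ 0) {g : GenContFract ℂ}
    (hgh : g.h = 1 - (h ^ 3)⁻¹)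
    (hg : ∀ n, g.s.get? n = some
      ⟨(h ^ 3)⁻¹ * ((1 - h⁻¹ * (h ^ 6) ^ n) * (1 - h ^ 7 * (h ^ 6) ^ n)),
        (1 - (h ^ 3)⁻¹) * (1 + h ^ 6 * (h ^ 6) ^ n)⟩) :
    Tendsto (fun n => g.convs n) atTop (𝓝 (-(h ^ 3)⁻¹ *
      (qProd (h ^ 10) (h ^ 12) * qProd (h ^ 2) (h ^ 12) /
        (qProd (h ^ 8) (h ^ 12) * qProd (h ^ 16) (h ^ 12))))) := by
  have hp : ‖h ^ 6‖ < 1 := norm_pow_lt_one hh (by norm_num)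
  have hpp : ‖h ^ 12‖ < 1 := norm_pow_lt_one hh (by norm_num)
  have hx := norm_pow_le_one hp
  have n1 := one_sub_inv_mul_pow_ne_zero hh h0
  have n7 : ∀ n : ℕ, 1 - h ^ 7 * (h ^ 6) ^ n ≠ 0 := fun n =>
    one_sub_pow_mul_ne_zero hh (hx n) (by norm_num)
  have n6 : ∀ n : ℕ, 1 + h ^ 6 * (h ^ 6) ^ n ≠ 0 := fun n =>
    one_add_pow_mul_ne_zero hh (hx n) (by norm_num)
  have n12 : ∀ n : ℕ, 1 + h ^ 12 * (h ^ 6) ^ n ≠ 0 := fun n =>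
    one_add_pow_mul_ne_zero hh (hx n) (by norm_num)
  -- The gauge factor that turns the contiguous relation for W into the recurrence of the continued
  -- fraction, solved by m n * W n.
  set m : ℕ → ℂ := fun n =>
    qPoch h⁻¹ (h ^ 6) n * qPoch (h ^ 7) (h ^ 6) n / qPoch (-h ^ 6) (h ^ 6) n with hm
  set W : ℕ → ℂ := fun n => cfSeries h ((h ^ 6) ^ n) with hW
  have hms : ∀ n, m (n + 1) = m n * ((1 - h⁻¹ * (h ^ 6) ^ n) * (1 - h ^ 7 * (h ^ 6) ^ n) /
      (1 + h ^ 6 * (h ^ 6) ^ n)) := by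
    intro n
    simp only [hm, qPoch_succ, neg_mul, sub_neg_eq_add, div_eq_mul_inv, mul_inv]
    ring
  have hm0 : m 0 = 1 := by simp [hm]
  have hmne : ∀ n, m n ≠ 0 := by
    intro n
    induction n with
    | zero => simp [hm0]
    | succ n ih =>
      rw [hms]
      exact mul_ne_zero ih (div_ne_zero (mul_ne_zero (n1 n) (n7 n)) (n6 n))
  have hms2 : ∀ n, m (n + 2) = m (n + 1) * ((1 - h ^ 5 * (h ^ 6) ^ n) *
      (1 - h ^ 13 * (h ^ 6) ^ n) / (1 + h ^ 12 * (h ^ 6) ^ n)) := by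
    intro n
    have e1 : h⁻¹ * (h ^ 6) ^ (n + 1) = h ^ 5 * (h ^ 6) ^ n := by
      rw [pow_succ']
      field_simp
    have e2 : h ^ 7 * (h ^ 6) ^ (n + 1) = h ^ 13 * (h ^ 6) ^ n := by ring
    have e3 : h ^ 6 * (h ^ 6) ^ (n + 1) = h ^ 12 * (h ^ 6) ^ n := by ring
    rw [hms, e1, e2, e3]
  have hWr : ∀ n, (1 + h ^ 6 * (h ^ 6) ^ n) * (1 + h ^ 12 * (h ^ 6) ^ n) *
      (W n - (1 - h ^ 3) * W (n + 1)) =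
      h ^ 3 * (1 - h ^ 5 * (h ^ 6) ^ n) * (1 - h ^ 13 * (h ^ 6) ^ n) * W (n + 2) := by
    intro n
    have := cfSeries_recurrence hh (hx n)
    simpa only [hW, pow_succ (h ^ 6)] using this
  have hWlim : Tendsto W atTop (𝓝 (cfSeries h 0)) := tendsto_cfSeries hh
  have hW0 := cfSeries_zero_ne_zero hh
  have hW0' : W 0 = qProd (h ^ 16) (h ^ 12) / qProd (h ^ 2) (h ^ 12) := by
    simp only [hW, pow_zero]
    exact cfSeries_one hh
  have q16 := qProd_ne_zero hpp (norm_pow_lt_one hh (m := 16) (by norm_num))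
  have q2 := qProd_ne_zero hpp (norm_pow_lt_one hh (m := 2) (by norm_num))
  have q8 := qProd_ne_zero hpp (norm_pow_lt_one hh (m := 8) (by norm_num))
  -- In m (n+2) / (-a n * m n) the two vanishing-prone factors of a n cancel and -h³ remains in the
  -- limit; as W (n+2) / W n → 1, this is σ.
  have hWev : ∀ᶠ n in atTop, W n ≠ 0 := hWlim.eventually_ne hW0
  have key := tendsto_convs_of_minimal (M := fun n => m n * W n) (σ := -h ^ 3) hg
    (fun n => mul_ne_zero (inv_ne_zero (pow_ne_zero 3 h0)) (mul_ne_zero (n1 n) (n7 n)))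
    (fun n => ?_) ?_ ?_ ?_ ?_
  · convert key using 2
    have hc := cfSeries_combination hh
    have e0 : cfSeries h 1 = W 0 := by simp [hW]
    have e1 : cfSeries h (h ^ 6) = W 1 := by simp [hW]
    have hn6 := n6 0
    rw [e0, e1] at hc
    rw [hgh, hms 0, hm0]
    rw [pow_zero, mul_one] at hn6
    simp only [pow_zero, mul_one, one_mul]
    have hW0ne : W 0 ≠ 0 := by
      rw [hW0']
      exact div_ne_zero q16 q2
    have e3 : qProd (h ^ 10) (h ^ 12) * qProd (h ^ 2) (h ^ 12) /
        (qProd (h ^ 8) (h ^ 12) * qProd (h ^ 16) (h ^ 12)) =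
        (qProd (h ^ 10) (h ^ 12) / qProd (h ^ 8) (h ^ 12)) / W 0 := by
      rw [hW0']
      field_simp
    rw [e3, ← hc]
    field_simp
    ring
  · have hr := hWr n
    rw [hms2, hms]
    have h6 := n6 n
    have h12 := n12 n
    have hW2 : (1 - h ^ 5 * (h ^ 6) ^ n) * (1 - h ^ 13 * (h ^ 6) ^ n) /
        (1 + h ^ 12 * (h ^ 6) ^ n) * W (n + 2) =
        (h ^ 3)⁻¹ * ((1 + h ^ 6 * (h ^ 6) ^ n) * (W n - (1 - h ^ 3) * W (n + 1))) := by
      field_simp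
      linear_combination -hr
    rw [mul_assoc, hW2]
    field_simp
    ring
  · rw [hm0, one_mul, hW0']
    exact div_ne_zero q16 q2
  · filter_upwards [hWev] with n hn using mul_ne_zero (hmne n) hn
  · rw [norm_neg]
    exact norm_pow_lt_one hh three_ne_zero
  · have h1 := tendsto_pow_atTop_nhds_zero_of_norm_lt_one hp
    have hlim : Tendsto (fun n : ℕ => -h ^ 3 * ((1 - h ^ 5 * (h ^ 6) ^ n) *
        (1 - h ^ 13 * (h ^ 6) ^ n) / ((1 + h ^ 6 * (h ^ 6) ^ n) * (1 + h ^ 12 * (h ^ 6) ^ n)) *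
        (W (n + 2) / W n))) atTop
        (𝓝 (-h ^ 3 * ((1 - h ^ 5 * 0) * (1 - h ^ 13 * 0) /
          ((1 + h ^ 6 * 0) * (1 + h ^ 12 * 0)) * (cfSeries h 0 / cfSeries h 0)))) := by
      refine Tendsto.const_mul _ (Tendsto.mul (Tendsto.div ?_ ?_ (by simp))
        (((tendsto_add_atTop_iff_nat 2).mpr hWlim).div hWlim hW0))
      · exact ((h1.const_mul _).const_sub 1).mul ((h1.const_mul _).const_sub 1)
      · exact ((h1.const_mul _).const_add 1).mul ((h1.const_mul _).const_add 1)
    rw [div_self hW0] at hlim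
    simp only [mul_zero, sub_zero, add_zero, mul_one, div_one] at hlim
    refine hlim.congr' ?_
    filter_upwards [hWev] with n hn
    have h6 := n6 n
    have h12 := n12 n
    have h7 := n7 n
    have hh1 := n1 n
    have hmn := hmne n
    rw [hms2, hms]
    generalize 1 - h⁻¹ * (h ^ 6) ^ n = d1 at *
    generalize 1 - h ^ 7 * (h ^ 6) ^ n = d2 at *
    generalize 1 + h ^ 6 * (h ^ 6) ^ n = d3 at *
    generalize 1 + h ^ 12 * (h ^ 6) ^ n = d4 at *
    field_simp

/-! ### Return to X(τ): convergents and modular equations. -/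

lemma qpow_eq_zpow (τ : ℂ) {r : ℚ} {m : ℤ} (hr : r * 4 = m) :
    qpow r τ = qpow (1 / 4) τ ^ m := by
  have hr' : (r : ℂ) * 4 = (m : ℂ) := by exact_mod_cast hr
  rw [qpow, qpow, ← Complex.exp_int_mul, ← hr']
  congr 1
  push_cast
  ring

lemma qpow_eq_pow (τ : ℂ) {r : ℚ} {m : ℕ} (hr : r * 4 = m) :
    qpow r τ = qpow (1 / 4) τ ^ m := by
  rw [qpow_eq_zpow τ (m := m) (by exact_mod_cast hr), zpow_natCast]

lemma qpow_three_mul (r : ℚ) (τ : ℂ) : qpow r (3 * τ) = qpow (3 * r) τ := by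
  rw [qpow, qpow]
  congr 1
  push_cast
  ring

lemma norm_qpow_lt_one {τ : ℂ} (hτ : 0 < τ.im) {r : ℚ} (hr : 0 < r) : ‖qpow r τ‖ < 1 := by
  rw [qpow, Complex.norm_exp, Real.exp_lt_one_iff]
  have e : 2 * (Real.pi : ℂ) * Complex.I * (r : ℂ) * τ =
      ((2 * Real.pi * r : ℝ) : ℂ) * (Complex.I * τ) := by
    push_cast
    ring
  rw [e, Complex.re_ofReal_mul, Complex.I_mul_re]
  have : (0 : ℝ) < r := by exact_mod_cast hr
  have := Real.pi_pos
  have : 0 < 2 * Real.pi * r * τ.im := by positivity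
  linarith

/-- The product defining `X` in terms of `q`-shifted factorials in `h = q ^ (1 / 2)`. -/
lemma X_eq {τ k : ℂ} (hk : k = qpow (1 / 4) τ) (hk1 : ‖k‖ < 1) :
    X τ = k * (qProd ((k ^ 2) ^ 10) ((k ^ 2) ^ 12) * qProd ((k ^ 2) ^ 2) ((k ^ 2) ^ 12) /
      (qProd ((k ^ 2) ^ 8) ((k ^ 2) ^ 12) * qProd ((k ^ 2) ^ 4) ((k ^ 2) ^ 12))) := by
  have hh : ‖k ^ 2‖ < 1 := norm_pow_lt_one hk1 two_ne_zero
  have hpp : ‖(k ^ 2) ^ 12‖ < 1 := norm_pow_lt_one hh (by norm_num)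
  have n8 := qProd_ne_zero hpp (norm_pow_lt_one hh (m := 8) (by norm_num))
  have n4 := qProd_ne_zero hpp (norm_pow_lt_one hh (m := 4) (by norm_num))
  have key := (((multipliable_qProd hpp ((k ^ 2) ^ 10)).hasProd.mul
    (multipliable_qProd hpp ((k ^ 2) ^ 2)).hasProd).div₀
    ((multipliable_qProd hpp ((k ^ 2) ^ 8)).hasProd.mul
    (multipliable_qProd hpp ((k ^ 2) ^ 4)).hasProd) (mul_ne_zero n8 n4)).tprod_eq
  rw [X, ← hk]
  congr 1
  refine Eq.trans (tprod_congr fun n => ?_) key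
  have e : ∀ (j m : ℕ), 2 * m = 4 * j →
      qpow (6 * n + j) τ = (k ^ 2) ^ m * ((k ^ 2) ^ 12) ^ n := by
    intro j m hj
    rw [qpow_eq_pow τ (m := 24 * n + 4 * j) (by push_cast; ring), ← hk, ← hj, pow_add]
    ring
  have e5 := e 5 10 (by norm_num)
  have e1 := e 1 2 (by norm_num)
  have e4 := e 4 8 (by norm_num)
  have e2 := e 2 4 (by norm_num)
  push_cast at e5 e1 e4 e2
  rw [e5, e1, e4, e2]

/-- Split both products in Gauss's formula for psi(q), q = k⁴, into three of base q⁶; dividing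
psi(q³) = (q⁶; q⁶)_∞ / (q³; q⁶)_∞ by the result cancels the classes 0 and 3. -/
lemma X_eq_psi {τ k : ℂ} (hk : k = qpow (1 / 4) τ) (hk1 : ‖k‖ < 1) :
    X τ = k * (psi ((k ^ 4) ^ 3) / psi (k ^ 4)) := by
  have hq : ‖k ^ 4‖ < 1 := norm_pow_lt_one hk1 (by norm_num)
  have hq3 : ‖(k ^ 4) ^ 3‖ < 1 := norm_pow_lt_one hq (by norm_num)
  have hq2 : ‖(k ^ 4) ^ 2‖ < 1 := norm_pow_lt_one hq (by norm_num)
  have hpp : ‖(k ^ 4) ^ 6‖ < 1 := norm_pow_lt_one hq (by norm_num)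
  have hne : ∀ m : ℕ, m ≠ 0 → qProd ((k ^ 4) ^ m) ((k ^ 4) ^ 6) ≠ 0 := fun m hm =>
    qProd_ne_zero hpp (norm_pow_lt_one hq hm)
  have e : ∀ m : ℕ, (k ^ 2) ^ (2 * m) = (k ^ 4) ^ m := fun m => by ring
  rw [X_eq hk hk1, show 10 = 2 * 5 from rfl, show 12 = 2 * 6 from rfl, show 8 = 2 * 4 from rfl,
    show (k ^ 2) ^ 2 = (k ^ 2) ^ (2 * 1) by ring, show (k ^ 2) ^ 4 = (k ^ 2) ^ (2 * 2) by ring]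
  simp only [e]
  rw [psi_eq hq, psi_eq hq3, qProd_eq_prod (m := 3) hq2 (k ^ 4) three_pos,
    qProd_eq_prod (m := 3) hq2 ((k ^ 4) ^ 2) three_pos]
  simp only [prod_range_succ, range_zero, prod_empty, one_mul]
  generalize k ^ 4 = q at *
  have a1 : (q ^ 2) ^ 3 = q ^ 6 := by ring
  have a2 : (q ^ 3) ^ 2 = q ^ 6 := by ring
  have a3 : q * (q ^ 2) ^ 0 = q ^ 1 := by ring
  have a4 : q * (q ^ 2) ^ 1 = q ^ 3 := by ring
  have a5 : q * (q ^ 2) ^ 2 = q ^ 5 := by ring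
  have a6 : q ^ 2 * (q ^ 2) ^ 0 = q ^ 2 := by ring
  have a7 : q ^ 2 * (q ^ 2) ^ 1 = q ^ 4 := by ring
  have a8 : q ^ 2 * (q ^ 2) ^ 2 = q ^ 6 := by ring
  rw [a1, a2, a3, a4, a5, a6, a7, a8]
  have := hne 1 (by norm_num)
  have := hne 2 (by norm_num)
  have := hne 3 (by norm_num)
  have := hne 4 (by norm_num)
  have := hne 5 (by norm_num)
  have := hne 6 (by norm_num)
  generalize qProd (q ^ 1) (q ^ 6) = r1 at *
  field_simp

lemma tendsto_convergent {τ : ℂ} (hτ : 0 < τ.im) :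
    Tendsto (convergent τ) atTop (𝓝 (X τ)) := by
  obtain ⟨k, hk⟩ : ∃ k, k = qpow (1 / 4) τ := ⟨_, rfl⟩
  have hk1 : ‖k‖ < 1 := hk ▸ norm_qpow_lt_one hτ (by norm_num)
  have hk0 : k ≠ 0 := hk ▸ Complex.exp_ne_zero _
  have hh : ‖k ^ 2‖ < 1 := norm_pow_lt_one hk1 two_ne_zero
  have hh0 : k ^ 2 ≠ 0 := pow_ne_zero 2 hk0
  have hpp : ‖(k ^ 2) ^ 12‖ < 1 := norm_pow_lt_one hh (by norm_num)
  have ha : qpow (-3 / 2) τ = ((k ^ 2) ^ 3)⁻¹ := by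
    rw [qpow_eq_zpow τ (m := -6) (by norm_num), ← hk, zpow_neg, ← pow_mul]
    norm_cast
  have hconv := tendsto_convs_orderSix hh hh0 (g := contFract τ)
    (by rw [← ha]; rfl) (fun n => ?_)
  · have e74 : qpow (7 / 4) τ = k ^ 7 := by
      rw [qpow_eq_pow τ (m := 7) (by norm_num), hk]
    have e2 : qpow 2 τ = k ^ 8 := by
      rw [qpow_eq_pow τ (m := 8) (by norm_num), hk]
    have h8 : k ^ 8 - 1 ≠ 0 := by
      rw [← neg_sub, neg_ne_zero]
      exact one_sub_ne_zero_of_norm_lt (norm_pow_lt_one hk1 (by norm_num))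
    have hlim := hconv.const_mul (qpow (7 / 4) τ / (qpow 2 τ - 1))
    refine (show X τ = _ from ?_) ▸ hlim
    have n8 := qProd_ne_zero hpp (norm_pow_lt_one hh (m := 8) (by norm_num))
    have n4 := qProd_ne_zero hpp (norm_pow_lt_one hh (m := 4) (by norm_num))
    have n16 := qProd_ne_zero hpp (norm_pow_lt_one hh (m := 16) (by norm_num))
    -- The evaluation involves h¹⁶ where X has h⁴, with h = k². The missing first factor is 1 - k⁸ =
    -- 1 - q², supplied by the prefactor q^(7/4) / (q² - 1).
    have hs : qProd ((k ^ 2) ^ 4) ((k ^ 2) ^ 12) =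
        (1 - k ^ 8) * qProd ((k ^ 2) ^ 16) ((k ^ 2) ^ 12) := by
      refine tendsto_nhds_unique ((tendsto_add_atTop_iff_nat 1).mpr (tendsto_qPoch hpp _))
        (((tendsto_qPoch hpp ((k ^ 2) ^ 16)).const_mul (1 - k ^ 8)).congr fun n => ?_)
      rw [qPoch_succ', ← pow_add, ← pow_mul k 2 4]
    have h8' : 1 - k ^ 8 ≠ 0 := one_sub_ne_zero_of_norm_lt (norm_pow_lt_one hk1 (by norm_num))
    rw [X_eq hk hk1, e74, e2, hs, ← neg_sub 1 (k ^ 8)]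
    generalize 1 - k ^ 8 = d at *
    field_simp
  · have hget : (contFract τ).s.get? n = some
        ⟨(qpow (1 / 4) τ - qpow (3 * n - 1 / 4) τ) * (qpow (-7 / 4) τ - qpow (3 * n + 7 / 4) τ),
          (1 - qpow (-3 / 2) τ) * (1 + qpow (3 * n + 3) τ)⟩ := rfl
    rw [hget]
    have e1 : qpow (3 * n - 1 / 4) τ = k ^ (12 * (n : ℤ) - 1) := by
      rw [qpow_eq_zpow τ (m := 12 * (n : ℤ) - 1) (by push_cast; ring), hk]
    have e2 : qpow (-7 / 4) τ = k ^ (-7 : ℤ) := by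
      rw [qpow_eq_zpow τ (m := -7) (by norm_num), hk]
    have e3 : qpow (3 * n + 7 / 4) τ = k ^ (12 * n + 7) := by
      rw [qpow_eq_pow τ (m := 12 * n + 7) (by push_cast; ring), hk]
    have e4 : qpow (3 * n + 3) τ = k ^ (12 * n + 12) := by
      rw [qpow_eq_pow τ (m := 12 * n + 12) (by push_cast; ring), hk]
    have z1 : k ^ (12 * (n : ℤ) - 1) = k ^ (12 * n) / k := by
      rw [zpow_sub_one₀ hk0, div_eq_mul_inv]
      norm_cast
    have z2 : k ^ (-7 : ℤ) = (k ^ 7)⁻¹ := by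
      rw [zpow_neg]
      norm_cast
    rw [e1, e2, e3, e4, z1, z2, ha, ← hk]
    congr 2
    · have : ((k ^ 2) ^ 6) ^ n = k ^ (12 * n) := by ring
      rw [this, pow_add]
      field_simp
    · congr 1
      ring

/-- The modular equations parametrising `X τ` and `X (3 τ)` by `w τ`. -/
theorem modular_equations {τ : ℂ} (hτ : 0 < τ.im) :
    X τ ^ 4 = w τ * (1 - 3 * w τ + 3 * w τ ^ 2) ∧
    1 - 3 * w τ + 3 * w τ ^ 2 ≠ 0 ∧
    X (3 * τ) ^ 4 = w τ ^ 3 / (1 - 3 * w τ + 3 * w τ ^ 2) := by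
  obtain ⟨k, hk⟩ : ∃ k, k = qpow (1 / 4) τ := ⟨_, rfl⟩
  have hk1 : ‖k‖ < 1 := hk ▸ norm_qpow_lt_one hτ (by norm_num)
  have hk0 : k ≠ 0 := hk ▸ Complex.exp_ne_zero _
  have hk3 : k ^ 3 = qpow (1 / 4) (3 * τ) := by
    rw [qpow_three_mul, qpow_eq_pow _ (m := 3) (by norm_num), hk]
  have hk31 : ‖k ^ 3‖ < 1 := norm_pow_lt_one hk1 three_ne_zero
  have hq : ‖k ^ 4‖ < 1 := norm_pow_lt_one hk1 (by norm_num)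
  have hX := X_eq_psi hk hk1
  have hX3 := X_eq_psi hk3 hk31
  have e3 : (k ^ 3) ^ 4 = (k ^ 4) ^ 3 := by ring
  have e9 : ((k ^ 4) ^ 3) ^ 3 = (k ^ 4) ^ 9 := by ring
  rw [e3, e9] at hX3
  have hR := psi_pow_four hq
  have p1 := psi_ne_zero hq
  have p3 := psi_ne_zero (norm_pow_lt_one hq (m := 3) (by norm_num))
  have p9 := psi_ne_zero (norm_pow_lt_one hq (m := 9) (by norm_num))
  have hw : w τ = k ^ 4 * psi ((k ^ 4) ^ 9) / psi (k ^ 4) := by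
    rw [w, hX, hX3]
    generalize psi ((k ^ 4) ^ 3) = b at *
    generalize psi ((k ^ 4) ^ 9) = c at *
    field_simp
  have hX0 : X τ ≠ 0 := hX ▸ mul_ne_zero hk0 (div_ne_zero p3 p1)
  -- This is `psi_pow_four` multiplied by q / psi(q)⁴.
  have h4 : X τ ^ 4 = w τ * (1 - 3 * w τ + 3 * w τ ^ 2) := by
    rw [hw, hX, mul_pow, div_pow, hR]
    field_simp
  have hne : 1 - 3 * w τ + 3 * w τ ^ 2 ≠ 0 := by
    intro h
    rw [h, mul_zero] at h4
    exact pow_ne_zero 4 hX0 h4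
  refine ⟨h4, hne, ?_⟩
  have hw0 : w τ ≠ 0 := by
    intro h
    rw [h, zero_mul] at h4
    exact pow_ne_zero 4 hX0 h4
  -- The second equation is the first one combined with X(τ)⁴ X(3τ)⁴ = w⁴.
  rw [eq_div_iff hne]
  refine mul_left_cancel₀ hw0 ?_
  rw [mul_left_comm, ← h4, w]
  ring

end

end OrderSix

theorem theorem7 (τ : UpperHalfPlane) :
    Filter.Tendsto (OrderSix.convergent (τ : ℂ)) Filter.atTop (nhds (OrderSix.X (τ : ℂ))) ∧
    OrderSix.X (τ : ℂ) ^ 4 =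
      OrderSix.w (τ : ℂ) * (1 - 3 * OrderSix.w (τ : ℂ) + 3 * OrderSix.w (τ : ℂ) ^ 2) ∧
    1 - 3 * OrderSix.w (τ : ℂ) + 3 * OrderSix.w (τ : ℂ) ^ 2 ≠ 0 ∧
    OrderSix.X (3 * (τ : ℂ)) ^ 4 =
      OrderSix.w (τ : ℂ) ^ 3 / (1 - 3 * OrderSix.w (τ : ℂ) + 3 * OrderSix.w (τ : ℂ) ^ 2) :=
  ⟨OrderSix.tendsto_convergent τ.im_pos, OrderSix.modular_equations τ.im_pos⟩
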